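/- Let $\mathcal{C}$ be a small category with a terminal object $1$ in which idempotents split, and let $p:\widehat{\mathcal{C}}\to\mathbf{Set}$ be the canonical geometric morphism from the topos of presheaves on $\mathcal{C}$: $p^*A$ is the constant presheaf $A$, $p_*X=X(1)$, and $p$ is local, i.e. $p_*$ has a fully faithful right adjoint $p^!$, namely $(p^!A)(C)=A^{\mathcal{C}(1,C)}$. Terminology. A subtopos of $\mathcal{E}$ is a geometric morphism $j:\mathcal{E}_j\to\mathcal{E}$ with $j_*$ fully faithful; it is essential if $j^*$ has a left adjoint. A subtopos $k$ is above a subtopos $j$ if $j_*$ factors up to isomorphism through $k_*$. The centre of a local $q:\mathcal{E}\to\mathcal{S}$ is the subtopos $q_*\dashv q^!:\mathcal{S}\to\mathcal{E}$. A local $q$ is a quality type if the canonical transformation $q^*\to q^!q_*q^*\cong q^!$ is an isomorphism. A subquality of a local $q:\mathcal{E}\to\mathcal{S}$ is a subtopos $j:\mathcal{E}_j\to\mathcal{E}$ above the centre of $q$ such that $qj:\mathcal{E}_j\to\mathcal{S}$ is a quality type. Level $\epsilon$ of $q$ is the largest (with respect to "above") essential subquality of $q$. For a Grothendieck topology $J$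 on $\mathcal{C}$, an object is $J$-irreducible if its only $J$-covering sieve is the maximal one, and $J$ is rigid if, for every object $B$, the sieve generated by all morphisms from $J$-irreducible objects to $B$ is $J$-covering. Let $\mathcal{C}_!\to\mathcal{C}$ be the full subcategory of the objects $C$ that have exactly one point $1\to C$, and let $\widehat{\mathcal{C}_!}\to\widehat{\mathcal{C}}$ be the induced essential subtopos (inverse image: restriction; direct image: right Kan extension). 1. If every Grothendieck topology on $\mathcal{C}$ is rigid, then $\widehat{\mathcal{C}_!}\to\widehat{\mathcal{C}}$ is level $\epsilon$ of $p:\widehat{\mathcal{C}}\to\mathbf{Set}$. 2. If $\mathcal{C}$ is finite, then $\widehat{\mathcal{C}_!}\to\widehat{\mathcal{C}}$ is level $\epsilon$ of $p:\widehat{\mathcal{C}}\to\mathbf{Set}$. 3. In particular this applies to graphic toposes: let $\mathcal{D}$ be a finite category whose endomorphisms satisfy $aba=ab$ (for all endomorphisms $a,b$ of the same object), and let $\mathcal{C}$ be its idempotent completion, so that $\widehat{\mathcal{C}}\simeq\widehat{\mathcal{D}}$. If $\mathcal{C}$ has a terminal object, then $\widehat{\mathcal{C}_!}\to\widehat{\mathcal{C}}$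 is level $\epsilon$ of $\widehat{\mathcal{C}}\to\mathbf{Set}$. -/

import Mathlib

open CategoryTheory CategoryTheory.Limits Opposite

universe u v w v₁ u₁ v₂ u₂ v₃ u₃

/-- A geometric morphism `F → E`: an adjunction (inverse image ⊣ direct image) whose inverse image
functor preserves finite limits. It is used below for toposes only. (A category with a
fully faithful direct image into a topos is automatically a topos.) -/
structure GeometricMorphism (F : Type u₁) [Category.{v₁} F] (E : Type u₂) [Category.{v₂} E] where
  /-- the inverse image functor -/
  inverse : E ⥤ F
  /-- the direct image functor -/
  direct : F ⥤ E
  /-- the inverse image is left adjoint to the direct image -/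
  adj : inverse ⊣ direct
  lex : PreservesFiniteLimits inverse

namespace GeometricMorphism

variable {F : Type u₁} [Category.{v₁} F] {E : Type u₂} [Category.{v₂} E]
  {S : Type u₃} [Category.{v₃} S]

/-- The composite `F → E → S` of geometric morphisms. -/
def comp (j : GeometricMorphism F E) (p : GeometricMorphism E S) : GeometricMorphism F S where
  inverse := p.inverse ⋙ j.inverse
  direct := j.direct ⋙ p.direct
  adj := p.adj.comp j.adj
  lex :=
    haveI := p.lex
    haveI := j.lex
    comp_preservesFiniteLimits p.inverse j.inverse

/-- A subtopos: a geometric morphism with full and faithful direct image. -/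
structure IsSubtopos (j : GeometricMorphism F E) : Prop where
  full : j.direct.Full
  faithful : j.direct.Faithful

/-- A geometric morphism is essential if its inverse image has a further left adjoint. -/
def IsEssential (j : GeometricMorphism F E) : Prop := j.inverse.IsRightAdjoint

/-- `k : G → E` is above `j : F → E` if the direct image of `j` factors, up to isomorphism,
through the direct image of `k`. -/
def IsAbove {G : Type u₃} [Category.{v₃} G] (k : GeometricMorphism G E)
    (j : GeometricMorphism F E) : Prop :=
  ∃ h : F ⥤ G, Nonempty (h ⋙ k.direct ≅ j.direct)

/-- The data that make a geometric morphism `p : E → S` local: a fully faithful right adjoint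
`p^!` of the direct image `p_*`. -/
structure Locality (p : GeometricMorphism E S) where
  /-- the further right adjoint `p^!` -/
  codirect : S ⥤ E
  /-- `p_* ⊣ p^!` -/
  coadj : p.direct ⊣ codirect
  fullyFaithful : codirect.FullyFaithful

namespace Locality

variable {p : GeometricMorphism E S} (hp : p.Locality)

/-- The adjoint string `p^* ⊣ p_* ⊣ p^!`. -/
def triple : Adjunction.Triple p.inverse p.direct hp.codirect where
  adj₁ := p.adj
  adj₂ := hp.coadj

/-- The centre (level 0) of a local `p : E → S`: the subtopos `S → E` with inverse image `p_*` and
direct image `p^!`. -/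
def centre : GeometricMorphism S E where
  inverse := p.direct
  direct := hp.codirect
  adj := hp.coadj
  lex :=
    haveI := p.adj.rightAdjoint_preservesLimits
    PreservesLimits.preservesFiniteLimits p.direct

/-- The canonical transformation `φ : p^* ⟶ p^!`, the composite of `η_{p^*} : p^* ⟶ p^! p_* p^*`
with the inverse of `p^! α : p^! ⟶ p^! p_* p^*`, where `η` is the unit of `p_* ⊣ p^!` and `α` is
the (invertible) unit of `p^* ⊣ p_*`. -/
noncomputable def phi : p.inverse ⟶ hp.codirect :=
  haveI := (hp.triple.fullyFaithfulEquiv.symm hp.fullyFaithful).full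
  haveI := (hp.triple.fullyFaithfulEquiv.symm hp.fullyFaithful).faithful
  hp.triple.leftToRight

end Locality

/-- A quality type: a local geometric morphism whose canonical `φ : q^* ⟶ q^!` is an
isomorphism. -/
def IsQualityType (q : GeometricMorphism E S) : Prop :=
  ∃ hq : q.Locality, IsIso hq.phi

/-- A subquality of the local `p : E → S`: a subtopos `j : F → E` above the centre of `p` such that
the composite `F → E → S` is a quality type. -/
structure IsSubquality {p : GeometricMorphism E S} (hp : p.Locality)
    (j : GeometricMorphism F E) : Prop where
  isSubtopos : j.IsSubtopos
  isAbove_centre : j.IsAbove hp.centre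
  isQualityType : (j.comp p).IsQualityType

/-- An essential subquality: a subquality that is essential as a subtopos. -/
structure IsEssentialSubquality {p : GeometricMorphism E S} (hp : p.Locality)
    (j : GeometricMorphism F E) : Prop where
  isSubquality : IsSubquality hp j
  isEssential : j.IsEssential

/-- `j` is level `ε` of the local `p : E → S`: it is the largest essential subquality of `p`. The
competitors `G → E` range over all categories `G` in the universes `w`, `v`. -/
structure IsLevelEpsilon {p : GeometricMorphism E S} (hp : p.Locality)
    (j : GeometricMorphism F E) : Prop where
  isEssentialSubquality : IsEssentialSubquality hp j
  isAbove : ∀ (G : Type w) [Category.{v} G] (k : GeometricMorphism G E),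
    IsEssentialSubquality hp k → j.IsAbove k

end GeometricMorphism

section Presheaves

variable (C : Type u) [SmallCategory C]

/-- `p^* : Set → Psh(C)`, the constant presheaf functor, is left adjoint to evaluation at the
terminal object. -/
noncomputable def constEvaluationAdj [HasTerminal C] :
    Functor.const Cᵒᵖ ⊣ (evaluation Cᵒᵖ (Type u)).obj (op (⊤_ C)) :=
  Adjunction.mkOfUnitCounit
    { unit := { app := fun A => 𝟙 A }
      counit :=
        { app := fun X =>
            { app := fun c => X.map (terminal.from c.unop).op
              naturality := fun c d f => by
                dsimp
                rw [Category.id_comp, ← X.map_comp]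
                congr 1
                exact Quiver.Hom.unop_inj (Subsingleton.elim _ _) } }
      left_triangle := by ext; simp
      right_triangle := by
        ext X x
        have : terminal.from (⊤_ C) = 𝟙 _ := Subsingleton.elim _ _
        simp [this] }

/-- The canonical geometric morphism `p : Psh(C) → Set`, for `C` with a terminal object `1`:
`p^* A` is the constant presheaf with value `A` and `p_* X = X(1)`. -/
noncomputable def presheafToSet [HasTerminal C] : GeometricMorphism (Cᵒᵖ ⥤ Type u) (Type u) where
  inverse := Functor.const Cᵒᵖ
  direct := (evaluation Cᵒᵖ (Type u)).obj (op (⊤_ C))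
  adj := constEvaluationAdj C
  lex := inferInstance

/-- `p^! : Set → Psh(C)`, with `(p^! A)(c)` the set of functions `C(1, c) → A`. -/
noncomputable def presheafCodirect [HasTerminal C] : Type u ⥤ Cᵒᵖ ⥤ Type u where
  obj A :=
    { obj := fun c => ((⊤_ C) ⟶ c.unop) → A
      map := fun f => ↾fun a x => a (x ≫ f.unop) }
  map g := { app := fun _ => ↾fun a x => g (a x) }

/-- `p_* ⊣ p^!`: a map `X(1) → A` corresponds to `X(c) → A ^ C(1, c)`, sending `s` to
`x ↦ g (s · x)`. -/
noncomputable def evaluationCodirectAdj [HasTerminal C] :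
    (evaluation Cᵒᵖ (Type u)).obj (op (⊤_ C)) ⊣ presheafCodirect C :=
  Adjunction.mkOfUnitCounit
    { unit :=
        { app := fun X =>
            { app := fun _ => ↾fun s x => X.map x.op s
              naturality := fun c d f => by
                ext s
                funext x
                simp [presheafCodirect] }
          naturality := fun X Y f => by
            ext c s
            funext x
            exact (NatTrans.naturality_apply f x.op s).symm }
      counit := { app := fun A => ↾fun a => a (𝟙 _) }
      left_triangle := by
        ext X s
        simp [presheafCodirect]
      right_triangle := by
        ext A c a
        funext x
        exact congrArg a (Category.id_comp x) }

/-- The canonical `p : Psh(C) → Set` is local. -/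
noncomputable def presheafToSetLocality [HasTerminal C] : (presheafToSet C).Locality where
  codirect := presheafCodirect C
  coadj := evaluationCodirectAdj C
  fullyFaithful :=
    haveI : IsIso (evaluationCodirectAdj C).counit := by
      have : ∀ A, IsIso ((evaluationCodirectAdj C).counit.app A) := fun A => by
        rw [isIso_iff_bijective]
        constructor
        · intro a b h
          funext x
          rw [show x = 𝟙 _ from Subsingleton.elim _ _]
          exact h
        · intro y
          exact ⟨fun _ => y, rfl⟩
      exact NatIso.isIso_of_isIso_app _
    (evaluationCodirectAdj C).fullyFaithfulROfIsIsoCounit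

variable {C} in
/-- The essential subtopos `Psh(D) → Psh(C)` induced by a full subcategory `D` of `C`: its inverse
image is restriction along the inclusion, and its direct image is right Kan extension. -/
noncomputable def presheafSubtopos (P : ObjectProperty C) :
    GeometricMorphism (P.FullSubcategoryᵒᵖ ⥤ Type u) (Cᵒᵖ ⥤ Type u) where
  inverse := (Functor.whiskeringLeft _ _ (Type u)).obj P.ι.op
  direct := P.ι.op.ran
  adj := P.ι.op.ranAdjunction (Type u)
  lex := inferInstance

/-- The objects of `C` with exactly one point `1 → X`; the full subcategory `C_!`. -/
def onePointed [HasTerminal C] : ObjectProperty C :=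
  fun X => Nonempty (Unique ((⊤_ C) ⟶ X))

end Presheaves

section Coverages

variable {C : Type u} [Category.{v} C]

/-- `B` is `J`-irreducible if every `J`-covering sieve on `B` is the maximal sieve. -/
def IsIrreducibleObject (J : GrothendieckTopology C) (B : C) : Prop :=
  ∀ S ∈ J B, S = ⊤

/-- `J` is rigid if, for every `B`, the sieve generated by all morphisms from `J`-irreducible
objects to `B` is `J`-covering. -/
def IsRigidTopology (J : GrothendieckTopology C) : Prop :=
  ∀ B : C, Sieve.generate (fun A (_ : A ⟶ B) => IsIrreducibleObject J A) ∈ J B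

end Coverages

/-- A category is finite if it has finitely many objects and morphisms. -/
structure IsFiniteCategory (C : Type u) [Category.{v} C] : Prop where
  finite_obj : Finite C
  finite_hom : ∀ X Y : C, Finite (X ⟶ Y)

/-- A graphic category: a finite category such that `a ∘ b ∘ a = a ∘ b` for all endomorphisms `a`,
`b` of the same object. Its topos of presheaves is a graphic topos. -/
structure IsGraphicCategory (C : Type u) [Category.{v} C] : Prop where
  isFinite : IsFiniteCategory C
  graphic : ∀ (X : C) (a b : X ⟶ X), a ≫ b ≫ a = b ≫ a

/-! In `C_!` the object 1 is both terminal and initial, so evaluation at 1 is adjoint to constants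
on both sides; this makes `C_!` an essential subquality. For maximality, give a subquality `k` the
finest topology `J` making every `k_* X` a sheaf. At a `J`-irreducible `B`, every map inverted by
`k^*` is bijective (`bijective_app_of_isIrreducibleObject`). With `q = pk`, this gives `A ≅ (k_* k^*
p^* A)(B) ≅ Hom(k^* yB, q^* A) ≅ Hom(q_* k^* yB, A) ≅ A ^ C(1, B)`, and `A = 2` forces `B` to have
exactly one point. If `J` is rigid, `C_!` is then `J`-dense, so `J`-sheaves are right Kan extended
from it (`isAbove_of_isCoverDense`). Over a finite category the least covering sieves form an
idempotent ideal, which is generated by idempotents; splitting these yields enough irreducibles. The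
graphic case follows because the Karoubi envelope of a finite category is finite. -/

/-! ### Rigidity of topologies on finite categories -/

theorem exists_isIdempotentElem_pow {M : Type*} [Monoid M] [Finite M] (a : M) :
    ∃ n : ℕ, IsIdempotentElem (a ^ (n + 1)) := by
  obtain ⟨i, j, hij, h⟩ := Finite.exists_ne_map_eq_of_infinite (fun n : ℕ => a ^ n)
  wlog hlt : i < j generalizing i j
  · exact this j i hij.symm h.symm (by omega)
  obtain ⟨d, rfl⟩ := Nat.exists_eq_add_of_lt hlt
  have step : ∀ m, i ≤ m → a ^ (m + (d + 1)) = a ^ m := fun m hm => by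
    obtain ⟨c, rfl⟩ := Nat.exists_eq_add_of_le hm
    have h' : a ^ i = a ^ (i + (d + 1)) := h
    rw [show i + c + (d + 1) = i + (d + 1) + c by ring, pow_add _ _ c, ← h', ← pow_add]
  have steps : ∀ k m, i ≤ m → a ^ (m + k * (d + 1)) = a ^ m := fun k => by
    induction k with
    | zero => simp
    | succ k ih =>
      intro m hm
      rw [Nat.succ_mul, ← add_assoc, step _ (by omega), ih m hm]
  -- Powers are periodic from `i` on with period `d + 1`; the exponent `(i + 1) * (d + 1)` is a
  -- multiple of the period and at least `i`.
  refine ⟨(i + 1) * (d + 1) - 1, ?_⟩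
  have hpos : 0 < (i + 1) * (d + 1) := by positivity
  rw [IsIdempotentElem, ← pow_add, Nat.sub_add_cancel hpos]
  exact steps (i + 1) _ (by nlinarith)

section Rigid

variable {C : Type u} [Category.{v} C]

theorem IsFiniteCategory.finite_sieve (hC : IsFiniteCategory C) (B : C) : Finite (Sieve B) := by
  have := hC.finite_obj
  have := hC.finite_hom
  refine Finite.of_injective (fun S : Sieve B => {f : Σ Y : C, Y ⟶ B | S f.2}) fun S T h => ?_
  ext Y f
  exact Set.ext_iff.1 h ⟨Y, f⟩

/-- Covering sieves are closed under binary intersection, so a minimal one is least. -/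
theorem IsFiniteCategory.exists_least_covering (hC : IsFiniteCategory C)
    (J : GrothendieckTopology C) (B : C) : ∃ S ∈ J B, ∀ T ∈ J B, S ≤ T := by
  have := hC.finite_sieve B
  obtain ⟨S, hS⟩ := (Set.toFinite (J B : Set (Sieve B))).exists_minimal ⟨⊤, J.top_mem B⟩
  exact ⟨S, hS.prop, fun T hT =>
    (hS.le_of_le (J.intersection_covering hS.prop hT) inf_le_left).trans inf_le_right⟩

/-- In a finite category, an idempotent ideal of arrows is generated by idempotents: here the ideal
is given by sieves `M X`, one for each object, closed under composition on the other side too. -/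
theorem IsFiniteCategory.exists_idempotent_factorization (hC : IsFiniteCategory C)
    (M : ∀ X : C, Sieve X)
    (hcomp : ∀ {A X B : C} (f : A ⟶ X) (h : X ⟶ B), M X f → M B (f ≫ h))
    (hidem : ∀ {A B : C} (f : A ⟶ B), M B f →
      ∃ (X : C) (g : A ⟶ X) (s : X ⟶ B), M X g ∧ M B s ∧ g ≫ s = f)
    {A B : C} (f : A ⟶ B) (hf : M B f) :
    ∃ (X : C) (t : A ⟶ X) (e : X ⟶ X) (p : X ⟶ B), M X e ∧ e ≫ e = e ∧ t ≫ e ≫ p = f := by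
  have := hC.finite_sieve B
  -- Among factorizations `f = t ≫ p` with `t` in the ideal, take one whose `p` generates a minimal
  -- sieve. Splitting `t = t' ≫ s` replaces `p` by `s ≫ p`, so minimality gives `p = h ≫ s ≫ p`; the
  -- idempotent sought is a power of `h ≫ s`.
  obtain ⟨⟨X, t, p⟩, ⟨ht, rfl⟩, hmin⟩ := exists_minimalFor_of_wellFoundedLT
    (fun x : Σ X : C, (A ⟶ X) × (X ⟶ B) => M x.1 x.2.1 ∧ x.2.1 ≫ x.2.2 = f)
    (fun x => Sieve.generate (Presieve.singleton x.2.2)) ⟨⟨B, f, 𝟙 B⟩, hf, by simp⟩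
  obtain ⟨Y, t', s, ht', hs, rfl⟩ := hidem t ht
  have hle := hmin (j := ⟨Y, t', s ≫ p⟩) ⟨ht', by simp⟩ (by
    rw [Sieve.generate_le_iff]
    rintro _ _ ⟨⟩
    exact ⟨X, s, p, ⟨⟩, rfl⟩)
  obtain ⟨_, h, _, ⟨⟩, hh⟩ := hle p ⟨X, 𝟙 X, p, ⟨⟩, by simp⟩
  have : Finite (End X) := hC.finite_hom X X
  obtain ⟨n, hn⟩ := exists_isIdempotentElem_pow (M := End X) (h ≫ s)
  have hfix : ∀ n : ℕ, ((End.of (h ≫ s)) ^ n : End X) ≫ p = p := fun n => by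
    induction n with
    | zero => exact Category.id_comp p
    | succ n ih =>
      rw [pow_succ, End.mul_def, Category.assoc, ih]
      simpa [End.of] using hh
  refine ⟨X, t' ≫ s, (End.of (h ≫ s)) ^ (n + 1), p, ?_, hn, ?_⟩
  · rw [pow_succ, End.mul_def]
    exact hcomp _ _ ((M X).downward_closed hs h)
  · rw [hfix]

/-- Every Grothendieck topology on a finite category with split idempotents is rigid. -/
theorem IsFiniteCategory.isRigidTopology [IsIdempotentComplete C] (hC : IsFiniteCategory C)
    (J : GrothendieckTopology C) : IsRigidTopology J := by
  choose M hM hleast using hC.exists_least_covering J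
  have hcomp : ∀ {A X B : C} (f : A ⟶ X) (h : X ⟶ B), M X f → M B (f ≫ h) :=
    fun f h hf => hleast _ _ (J.pullback_stable h (hM _)) _ hf
  intro B
  refine J.superset_covering (fun A f hf => ?_) (hM B)
  obtain ⟨X, t, e, p, he, hee, rfl⟩ := hC.exists_idempotent_factorization M hcomp
    -- Transitivity of `J`: composites of two members of `M` form a covering sieve, which therefore
    -- contains `M B`.
    (fun {A B} f hf => by
      obtain ⟨X, g, s, hs, hg, h⟩ := hleast B _
        (J.bind_covering (R := fun Y _ _ => M Y) (hM B) fun Y _ _ => hM Y) f hf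
      exact ⟨X, g, s, hg, hs, h⟩) f hf
  obtain ⟨E, i, r, hir, hri⟩ := IsIdempotentComplete.idempotents_split X e hee
  -- The least covering sieve on `E` contains the identity, so `E` is irreducible.
  have hE : M E (𝟙 E) := by
    have : i ≫ e ≫ r = 𝟙 E := by rw [← hri]; simp [hir]
    rw [← this, ← Category.assoc]
    exact hcomp _ _ ((M X).downward_closed he i)
  exact ⟨E, t ≫ r, i ≫ p, fun S hS => Sieve.id_mem_iff_eq_top.1 (hleast E S hS _ hE), by
    simp [← hri]⟩

theorem IsFiniteCategory.karoubi (hC : IsFiniteCategory C) :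
    IsFiniteCategory (Idempotents.Karoubi C) where
  finite_obj := by
    have := hC.finite_obj
    have := hC.finite_hom
    refine Finite.of_injective
      (fun P : Idempotents.Karoubi C => (⟨P.X, P.p⟩ : Σ X : C, X ⟶ X)) fun P Q h => ?_
    cases P; cases Q; cases h; rfl
  finite_hom P Q := by
    have := hC.finite_hom P.X Q.X
    exact Finite.of_injective (fun f : P ⟶ Q => f.f) fun f g h => Idempotents.Karoubi.hom_ext f g h

end Rigid

/-! ### Quality types through adjoints -/

namespace GeometricMorphism

variable {F : Type u₁} [Category.{v₁} F] {E : Type u₂} [Category.{v₂} E]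
  {S : Type u₃} [Category.{v₃} S]

/-- If the direct image of `q` is left adjoint to its fully faithful inverse image, then `q` is a
quality type. -/
theorem isQualityType_of_adj (q : GeometricMorphism E S) (adj : q.direct ⊣ q.inverse)
    (h : q.inverse.FullyFaithful) : q.IsQualityType := by
  let hq : q.Locality := ⟨q.inverse, adj, h⟩
  have := h.full
  have := h.faithful
  refine ⟨hq, ?_⟩
  have : ∀ A, IsIso (hq.phi.app A) := fun A => by
    -- Both factors are invertible because `q^*` is fully faithful.
    have e : hq.phi.app A = adj.unit.app (q.inverse.obj A) ≫
        inv (q.inverse.map (q.adj.unit.app A)) := hq.triple.leftToRight_app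
    rw [e]
    infer_instance
  exact NatIso.isIso_of_isIso_app _

/-- For a quality type, the direct image is left adjoint to the inverse image. -/
theorem IsQualityType.nonempty_adj {q : GeometricMorphism E S} (h : q.IsQualityType) :
    Nonempty (q.direct ⊣ q.inverse) := by
  obtain ⟨hq, _⟩ := h
  exact ⟨hq.coadj.ofNatIsoRight (asIso hq.phi).symm⟩

end GeometricMorphism

/-! ### The one-pointed objects form an essential subquality -/

section OnePointed

variable (C : Type u) [SmallCategory C]

theorem nonempty_fullyFaithful_const {D : Type u} [SmallCategory D] [HasTerminal D] :
    Nonempty (Functor.const Dᵒᵖ : Type u ⥤ Dᵒᵖ ⥤ Type u).FullyFaithful := by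
  have : IsIso (constEvaluationAdj D).unit :=
    have : ∀ A, IsIso ((constEvaluationAdj D).unit.app A) := fun A =>
      inferInstanceAs (IsIso (𝟙 A))
    NatIso.isIso_of_isIso_app _
  exact ⟨(constEvaluationAdj D).fullyFaithfulLOfIsIsoUnit⟩

/-- If `t` is initial in `D`, evaluation of presheaves at `t` is left adjoint to the constant
presheaf functor. -/
noncomputable def evaluationConstAdj {D : Type u} [SmallCategory D] {t : D} (ht : IsInitial t) :
    (evaluation Dᵒᵖ (Type u)).obj (op t) ⊣ Functor.const Dᵒᵖ :=
  Adjunction.mkOfUnitCounit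
    { unit :=
        { app := fun X =>
            { app := fun c => X.map (ht.to c.unop).op
              naturality := fun c d f => by
                dsimp
                rw [Category.comp_id, ← X.map_comp]
                congr 1
                exact Quiver.Hom.unop_inj (ht.hom_ext _ _) } }
      counit := { app := fun A => 𝟙 A }
      left_triangle := by
        ext X x
        simp
      right_triangle := by ext; simp }

variable [HasTerminal C]

/-- The terminal object of `C`, as an object with exactly one point. -/
noncomputable def onePointedTerminal : (onePointed C).FullSubcategory :=
  ⟨⊤_ C, ⟨inferInstance⟩⟩

noncomputable def onePointedTerminalIsTerminal : IsTerminal (onePointedTerminal C) :=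
  IsTerminal.ofUniqueHom (fun X => ObjectProperty.homMk (terminal.from X.obj))
    fun _ _ => ObjectProperty.hom_ext _ (terminalIsTerminal.hom_ext _ _)

noncomputable def onePointedTerminalIsInitial : IsInitial (onePointedTerminal C) :=
  IsInitial.ofUniqueHom (fun X => ObjectProperty.homMk X.property.some.default)
    fun X _ => ObjectProperty.hom_ext _ (X.property.some.uniq _)

instance : HasTerminal (onePointed C).FullSubcategory :=
  (onePointedTerminalIsTerminal C).hasTerminal

/-- The terminal object of `C_!` is also initial. -/
noncomputable def terminalOnePointedIsInitial : IsInitial (⊤_ (onePointed C).FullSubcategory) :=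
  (onePointedTerminalIsInitial C).ofIso
    ((onePointedTerminalIsTerminal C).uniqueUpToIso terminalIsTerminal)

/-- Restricting to `C_!` and evaluating at its terminal object is evaluation at the terminal
object of `C`. -/
noncomputable def restrictionEvaluationIso :
    (presheafSubtopos (onePointed C)).inverse ⋙
      (evaluation (onePointed C).FullSubcategoryᵒᵖ (Type u)).obj (op (⊤_ _)) ≅
    (presheafToSet C).direct :=
  (evaluation Cᵒᵖ (Type u)).mapIso ((onePointed C).ι.mapIso
    ((onePointedTerminalIsTerminal C).uniqueUpToIso terminalIsTerminal)).op

theorem presheafSubtopos_isSubtopos {C : Type u} [SmallCategory C] (P : ObjectProperty C) :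
    (presheafSubtopos P).IsSubtopos :=
  have : IsIso (presheafSubtopos P).adj.counit :=
    inferInstanceAs (IsIso (P.ι.op.ranAdjunction (Type u)).counit)
  have h := (presheafSubtopos P).adj.fullyFaithfulROfIsIsoCounit
  ⟨h.full, h.faithful⟩

theorem presheafSubtopos_isEssential {C : Type u} [SmallCategory C] (P : ObjectProperty C) :
    (presheafSubtopos P).IsEssential :=
  (P.ι.op.lanAdjunction (Type u)).isRightAdjoint

/-- Evaluation at 1 factors through restriction to `C_!`; taking right adjoints factors `p^!`
through the right Kan extension. -/
theorem presheafSubtopos_onePointed_isAbove_centre :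
    (presheafSubtopos (onePointed C)).IsAbove (presheafToSetLocality C).centre :=
  ⟨presheafCodirect _, ⟨Adjunction.rightAdjointUniq
    (((presheafSubtopos (onePointed C)).adj.comp (evaluationCodirectAdj _)).ofNatIsoLeft
      (restrictionEvaluationIso C)) (presheafToSetLocality C).coadj⟩⟩

theorem presheafSubtopos_onePointed_isQualityType :
    ((presheafSubtopos (onePointed C)).comp (presheafToSet C)).IsQualityType := by
  let q := (presheafSubtopos (onePointed C)).comp (presheafToSet C)
  let e : q.inverse ≅ Functor.const (onePointed C).FullSubcategoryᵒᵖ := Iso.refl _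
  have e' : q.direct ≅ (evaluation _ (Type u)).obj (op (⊤_ (onePointed C).FullSubcategory)) :=
    Adjunction.rightAdjointUniq q.adj ((constEvaluationAdj _).ofNatIsoLeft e.symm)
  exact q.isQualityType_of_adj
    (((evaluationConstAdj (terminalOnePointedIsInitial C)).ofNatIsoLeft e'.symm).ofNatIsoRight
      e.symm) (nonempty_fullyFaithful_const.some.ofIso e.symm)

theorem presheafSubtopos_onePointed_isEssentialSubquality :
    GeometricMorphism.IsEssentialSubquality (presheafToSetLocality C)
      (presheafSubtopos (onePointed C)) where
  isSubquality :=
    { isSubtopos := presheafSubtopos_isSubtopos _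
      isAbove_centre := presheafSubtopos_onePointed_isAbove_centre C
      isQualityType := presheafSubtopos_onePointed_isQualityType C }
  isEssential := presheafSubtopos_isEssential _

end OnePointed

/-- An empty `T` admits only one function; two points `x ≠ y` give at least three: both constants
and the indicator of `x`. -/
theorem nonempty_unique_of_equiv_arrow_bool {T : Type*} (e : Bool ≃ (T → Bool)) :
    Nonempty (Unique T) := by
  classical
  have hne : Nonempty T := by
    by_contra h
    rw [not_nonempty_iff] at h
    exact absurd (e.injective (Subsingleton.elim (e true) (e false))) (by simp)
  have hsub : Subsingleton T := by
    refine ⟨fun x y => by_contra fun hxy => ?_⟩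
    have h₁ : e.symm (fun _ => true) ≠ e.symm (fun _ => false) := fun h => by
      simpa using congrFun (e.symm.injective h) x
    have h₂ : e.symm (fun _ => true) ≠ e.symm (fun t => decide (t = x)) := fun h => by
      simpa [Ne.symm hxy] using congrFun (e.symm.injective h) y
    have h₃ : e.symm (fun _ => false) ≠ e.symm (fun t => decide (t = x)) := fun h => by
      simpa using congrFun (e.symm.injective h) x
    revert h₁ h₂ h₃
    generalize e.symm (fun _ => true) = a
    generalize e.symm (fun _ => false) = b
    generalize e.symm (fun t => decide (t = x)) = c
    revert a b c
    decide
  exact ⟨⟨⟨hne.some⟩, fun _ => Subsingleton.elim _ _⟩⟩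

/-! ### Sieves as finite limits, so that a lex functor can be applied to them -/

section SievesAsLimits

variable {C : Type u} [SmallCategory C] {F G : Cᵒᵖ ⥤ Type u}

theorem CategoryTheory.Presheaf.pullback_equalizerSieve {B Y : C} (x y : F.obj (op B))
    (f : Y ⟶ B) : (Presheaf.equalizerSieve (F := F) (X := op B) x y).pullback f =
      Presheaf.equalizerSieve (F := F) (X := op Y) (F.map f.op x) (F.map f.op y) := by
  ext Z g
  simp [Presheaf.equalizerSieve]

/-- The equalizer sieve of two sections is the equalizer of the corresponding maps. -/
theorem CategoryTheory.Presheaf.exists_isLimit_equalizerSieve {B : C} (x y : F.obj (op B)) :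
    ∃ w, Nonempty (IsLimit (Fork.ofι (f := yonedaEquiv.symm x) (g := yonedaEquiv.symm y)
      (Presheaf.equalizerSieve (F := F) (X := op B) x y).functorInclusion w)) := by
  refine ⟨?_, ⟨Fork.IsLimit.mk' _ fun s => ⟨?_, ?_, ?_⟩⟩⟩
  · ext Z ⟨g, hg⟩
    exact hg
  · exact
      { app := fun Z => ↾fun z => ⟨s.ι.app Z z, by
          have := ConcreteCategory.congr_hom (congr_app s.condition Z) z
          exact this⟩
        naturality := fun Z W f => by
          ext z
          have h := ConcreteCategory.congr_hom (s.ι.naturality f) z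
          exact Subtype.ext h }
  · rfl
  · intro m hm
    ext Z z
    have h := ConcreteCategory.congr_hom (congr_app hm Z) z
    exact Subtype.ext h

/-- For a monomorphism `m` the sieve of restrictions of `s` that lie in the image of `m` is the
pullback of `m`. -/
theorem CategoryTheory.Presheaf.exists_isPullback_imageSieve (m : F ⟶ G)
    (hm : ∀ Z, Function.Injective (m.app Z)) {B : C} (s : G.obj (op B)) :
    ∃ t : (Presheaf.imageSieve m s).functor ⟶ F,
      IsPullback t (Presheaf.imageSieve m s).functorInclusion m (yonedaEquiv.symm s) := by
  choose t ht using fun (Z : Cᵒᵖ) (g : (Presheaf.imageSieve m s).functor.obj Z) => g.2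
  refine ⟨{ app := fun Z => ↾(t Z), naturality := fun Z W f => ?_ },
    IsPullback.of_forall_isPullback_app fun Z => ?_⟩
  · ext g
    apply hm
    refine (ht _ _).trans ?_
    change _ = m.app W (F.map f (t Z g))
    rw [NatTrans.naturality_apply m f, ht]
    change G.map (f.unop ≫ g.1).op s = _
    simp
  · rw [Types.isPullback_iff]
    refine ⟨?_, fun g g' h => Subtype.ext h.2, fun x g h => ?_⟩
    · ext g
      exact ht Z g
    · exact ⟨⟨g, x, h⟩, hm _ ((ht _ _).trans h.symm), rfl⟩

end SievesAsLimits

/-! ### The topology of a subquality and its irreducible objects -/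

namespace GeometricMorphism

variable {C : Type u} [SmallCategory C] {E : Type w} [Category.{v} E]
  (k : GeometricMorphism E (Cᵒᵖ ⥤ Type u))

theorem bijective_comp_of_isIso_inverse_map {U V : Cᵒᵖ ⥤ Type u} (m : U ⟶ V)
    [IsIso (k.inverse.map m)] (X : E) :
    Function.Bijective (fun g : V ⟶ k.direct.obj X => m ≫ g) := by
  have h : (fun g : V ⟶ k.direct.obj X => m ≫ g) =
      k.adj.homEquiv U X ∘ (fun g => k.inverse.map m ≫ g) ∘ (k.adj.homEquiv V X).symm := by
    funext g
    simp [Adjunction.homEquiv_naturality_left]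
  rw [h]
  exact (Equiv.bijective _).comp (((asIso (k.inverse.map m)).homFromEquiv.symm.bijective).comp
    (Equiv.bijective _))

/-- The finest topology for which all direct images are sheaves. -/
def topology : GrothendieckTopology C := Sheaf.finestTopology (Set.range k.direct.obj)

theorem isSheaf_direct (X : E) : Presieve.IsSheaf k.topology (k.direct.obj X) :=
  Sheaf.sheaf_for_finestTopology _ ⟨X, rfl⟩

/-- By adjunction, maps into `k_* X` extend uniquely along anything `k^*` inverts, which is the
sheaf condition. -/
theorem mem_topology_of_isIso {B : C} (S : Sieve B)
    (h : ∀ ⦃Y : C⦄ (f : Y ⟶ B), IsIso (k.inverse.map (S.pullback f).functorInclusion)) :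
    S ∈ k.topology B := by
  refine Sheaf.mem_finestTopology_of_forall_isSheafFor ?_
  rintro _ ⟨X, rfl⟩ Y f
  rw [Presieve.isSheafFor_iff_yonedaSheafCondition]
  have := h f
  exact (Function.bijective_iff_existsUnique _).1
    (k.bijective_comp_of_isIso_inverse_map (S.pullback f).functorInclusion X)

variable {F G : Cᵒᵖ ⥤ Type u}

theorem equalizerSieve_mem_topology (m : F ⟶ G) [IsIso (k.inverse.map m)] {B : C}
    (x y : F.obj (op B)) (h : m.app _ x = m.app _ y) :
    Presheaf.equalizerSieve (F := F) (X := op B) x y ∈ k.topology B := by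
  have := k.lex
  refine k.mem_topology_of_isIso _ fun Y f => ?_
  rw [Presheaf.pullback_equalizerSieve]
  obtain ⟨_, ⟨hl⟩⟩ :=
    Presheaf.exists_isLimit_equalizerSieve (B := Y) (F.map f.op x) (F.map f.op y)
  -- The two sections agree after `m`, which `k^*` inverts, so `k^*` sends the sieve to an equalizer
  -- of equal maps.
  refine isIso_limit_cone_parallelPair_of_eq ?_ (isLimitForkMapOfIsLimit k.inverse _ hl)
  rw [← cancel_mono (k.inverse.map m), ← k.inverse.map_comp, ← k.inverse.map_comp]
  congr 1
  apply yonedaEquiv.injective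
  simp [yonedaEquiv_comp, NatTrans.naturality_apply, h]

theorem imageSieve_mem_topology (m : F ⟶ G) [IsIso (k.inverse.map m)] {B : C}
    (s : G.obj (op B)) : Presheaf.imageSieve m s ∈ k.topology B := by
  have := k.lex
  refine k.mem_topology_of_isIso _ fun Y f => ?_
  rw [Presheaf.pullback_imageSieve]
  -- The invertible `k^* m` factors through this mono, making it split epi as well.
  have hι : IsIso (k.inverse.map (Subfunctor.range m).ι) := by
    have : IsSplitEpi (k.inverse.map (Subfunctor.range m).ι) :=
      IsSplitEpi.mk' ⟨inv (k.inverse.map m) ≫ k.inverse.map (Subfunctor.toRange m), by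
        rw [Category.assoc, ← k.inverse.map_comp, Subfunctor.toRange_ι, IsIso.inv_hom_id]⟩
    exact isIso_of_mono_of_isSplitEpi _
  obtain ⟨t, ht⟩ := Presheaf.exists_isPullback_imageSieve (Subfunctor.range m).ι
    (fun _ => Subtype.val_injective) (G.map f.op s)
  have hS : Presheaf.imageSieve m (G.map f.op s) =
      Presheaf.imageSieve (Subfunctor.range m).ι (G.map f.op s) := by
    ext Z g
    constructor
    · rintro ⟨a, ha⟩
      exact ⟨⟨_, a, rfl⟩, ha⟩
    · rintro ⟨⟨_, a, rfl⟩, ha⟩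
      exact ⟨a, ha⟩
  rw [hS]
  exact (ht.map k.inverse).isIso_snd_of_isIso

theorem bijective_app_of_isIrreducibleObject (m : F ⟶ G) [IsIso (k.inverse.map m)] {B : C}
    (hB : IsIrreducibleObject k.topology B) : Function.Bijective (m.app (op B)) := by
  refine ⟨fun x y h => ?_, fun s => ?_⟩
  · exact (Presheaf.equalizerSieve_eq_top_iff (F := F) (X := op B) x y).1
      (hB _ (k.equalizerSieve_mem_topology m x y h))
  · obtain ⟨t, ht⟩ := Sieve.id_mem_iff_eq_top.2 (hB _ (k.imageSieve_mem_topology m s))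
    exact ⟨t, by simpa using ht⟩

/-- Each `p^! A` is a direct image along `k`, so `Hom(p_* m, A) ≅ Hom(m, p^! A)` is bijective for
all `A`; Yoneda concludes. -/
theorem isIso_direct_map_of_isAbove_centre {S : Type u₃} [Category.{v₃} S]
    {p : GeometricMorphism (Cᵒᵖ ⥤ Type u) S} (hp : p.Locality) (hk : k.IsAbove hp.centre)
    (m : F ⟶ G) [IsIso (k.inverse.map m)] : IsIso (p.direct.map m) := by
  obtain ⟨h, ⟨(e : h ⋙ k.direct ≅ hp.codirect)⟩⟩ := hk
  refine isIso_of_coyoneda_map_bijective _ fun A => ?_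
  have heq : (fun g : p.direct.obj G ⟶ A => p.direct.map m ≫ g) =
      ((hp.coadj.homEquiv F A).trans (e.app A).symm.homToEquiv).symm ∘ (fun g => m ≫ g) ∘
        ((hp.coadj.homEquiv G A).trans (e.app A).symm.homToEquiv) := by
    funext g
    apply ((hp.coadj.homEquiv F A).trans (e.app A).symm.homToEquiv).injective
    simp [Adjunction.homEquiv_naturality_left]
  rw [heq]
  exact (Equiv.bijective _).comp ((k.bijective_comp_of_isIso_inverse_map m (h.obj A)).comp
    (Equiv.bijective _))

/-- For a subquality of `Psh(C)`, the irreducible objects have exactly one point. -/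
theorem IsSubquality.onePointed_of_isIrreducibleObject [HasTerminal C]
    {k : GeometricMorphism E (Cᵒᵖ ⥤ Type u)} (hk : IsSubquality (presheafToSetLocality C) k)
    {B : C} (hB : IsIrreducibleObject k.topology B) : onePointed C B := by
  have := hk.isSubtopos.full
  have := hk.isSubtopos.faithful
  obtain ⟨adj⟩ := IsQualityType.nonempty_adj hk.isQualityType
  -- The two-element set, lifted to the universe of the presheaves.
  let A : Type u := ULift Bool
  let K : Cᵒᵖ ⥤ Type u := (presheafToSet C).inverse.obj A
  have : IsIso ((presheafToSet C).direct.map (k.adj.unit.app (yoneda.obj B))) :=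
    k.isIso_direct_map_of_isAbove_centre _ hk.isAbove_centre _
  let e₁ : A ≃ (k.direct.obj (k.inverse.obj K)).obj (op B) :=
    Equiv.ofBijective _ (k.bijective_app_of_isIrreducibleObject (k.adj.unit.app K) hB)
  let e₂ : (k.inverse.obj (yoneda.obj B) ⟶ k.inverse.obj K) ≃
      (k.direct.obj (k.inverse.obj K)).obj (op B) :=
    (k.adj.homEquiv _ _).trans yonedaEquiv
  let e₃ : (((presheafToSet C).direct.obj (k.direct.obj (k.inverse.obj (yoneda.obj B)))) ⟶ A) ≃
      (k.inverse.obj (yoneda.obj B) ⟶ k.inverse.obj K) := adj.homEquiv _ _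
  let e₄ : ((⊤_ C ⟶ B) ⟶ A) ≃
      (((presheafToSet C).direct.obj (k.direct.obj (k.inverse.obj (yoneda.obj B)))) ⟶ A) :=
    (asIso ((presheafToSet C).direct.map (k.adj.unit.app (yoneda.obj B)))).homFromEquiv
  let e₅ : ((⊤_ C ⟶ B) ⟶ A) ≃ ((⊤_ C ⟶ B) → Bool) :=
    TypeCat.homEquiv.trans (Equiv.arrowCongr (Equiv.refl _) Equiv.ulift)
  exact nonempty_unique_of_equiv_arrow_bool
    (Equiv.ulift.symm.trans (e₁.trans (e₂.symm.trans (e₃.symm.trans (e₄.symm.trans e₅)))))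

/-- A map into a sheaf is determined by, and extends from, its restriction to a dense subcategory;
hence the unit of restriction and right Kan extension is invertible at each `k_* X`. -/
theorem isAbove_of_isCoverDense (P : ObjectProperty C) (k : GeometricMorphism E (Cᵒᵖ ⥤ Type u))
    [P.ι.IsCoverDense k.topology] : (presheafSubtopos P).IsAbove k := by
  have hiso : ∀ X, IsIso ((presheafSubtopos P).adj.unit.app (k.direct.obj X)) := fun X => by
    refine isIso_of_yoneda_map_bijective _ fun Y => ?_
    have hb := Functor.whiskerLeft_obj_map_bijective_of_isCoverDense (K := k.topology) P.ι Y
      (k.direct.obj X) ((isSheaf_iff_isSheaf_of_type _ _).2 (k.isSheaf_direct X))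
    have heq : (fun g : Y ⟶ k.direct.obj X =>
        g ≫ (presheafSubtopos P).adj.unit.app (k.direct.obj X)) =
        (presheafSubtopos P).adj.homEquiv _ _ ∘ (presheafSubtopos P).inverse.map := by
      funext g
      simp [Adjunction.homEquiv_unit]
    exact heq ▸ (Equiv.bijective _).comp hb
  have : IsIso (Functor.whiskerLeft k.direct (presheafSubtopos P).adj.unit) :=
    have : ∀ X, IsIso ((Functor.whiskerLeft k.direct (presheafSubtopos P).adj.unit).app X) := hiso
    NatIso.isIso_of_isIso_app _
  exact ⟨k.direct ⋙ (presheafSubtopos P).inverse,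
    ⟨(asIso (Functor.whiskerLeft k.direct (presheafSubtopos P).adj.unit)).symm⟩⟩

theorem IsSubquality.presheafSubtopos_onePointed_isAbove [HasTerminal C]
    {k : GeometricMorphism E (Cᵒᵖ ⥤ Type u)} (hk : IsSubquality (presheafToSetLocality C) k)
    (hrigid : IsRigidTopology k.topology) : (presheafSubtopos (onePointed C)).IsAbove k := by
  have : (onePointed C).ι.IsCoverDense k.topology := ⟨fun B => by
    refine k.topology.superset_covering ?_ (hrigid B)
    rintro Y f ⟨A, g, h, hA, rfl⟩
    exact ⟨⟨⟨A, hk.onePointed_of_isIrreducibleObject hA⟩, g, h, rfl⟩⟩⟩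
  exact isAbove_of_isCoverDense _ k

end GeometricMorphism

/-! ### Level epsilon -/

theorem presheafSubtopos_onePointed_isLevelEpsilon (C : Type u) [SmallCategory C] [HasTerminal C]
    (hC : ∀ J : GrothendieckTopology C, IsRigidTopology J) :
    GeometricMorphism.IsLevelEpsilon.{v, w} (presheafToSetLocality C)
      (presheafSubtopos (onePointed C)) where
  isEssentialSubquality := presheafSubtopos_onePointed_isEssentialSubquality C
  isAbove _ _ _ hk := hk.isSubquality.presheafSubtopos_onePointed_isAbove (hC _)

theorem mainTheorem7 :
    (∀ (C : Type u) [SmallCategory C] [HasTerminal C] [IsIdempotentComplete C],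
      (∀ J : GrothendieckTopology C, IsRigidTopology J) →
        GeometricMorphism.IsLevelEpsilon.{v, w} (presheafToSetLocality C)
          (presheafSubtopos (onePointed C))) ∧
    (∀ (C : Type u) [SmallCategory C] [HasTerminal C] [IsIdempotentComplete C],
      IsFiniteCategory C →
        GeometricMorphism.IsLevelEpsilon.{v, w} (presheafToSetLocality C)
          (presheafSubtopos (onePointed C))) ∧
    (∀ (D : Type u) [SmallCategory D] [HasTerminal (Idempotents.Karoubi D)],
      IsGraphicCategory D →
        GeometricMorphism.IsLevelEpsilon.{v, w} (presheafToSetLocality (Idempotents.Karoubi D))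
          (presheafSubtopos (onePointed (Idempotents.Karoubi D)))) := by
  exact ⟨fun C _ _ _ hC => presheafSubtopos_onePointed_isLevelEpsilon C hC,
    fun C _ _ _ hC => presheafSubtopos_onePointed_isLevelEpsilon C hC.isRigidTopology,
    fun D _ _ hD =>
      presheafSubtopos_onePointed_isLevelEpsilon _ hD.isFinite.karoubi.isRigidTopology⟩
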